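/- Let $E,F\subset\mathbb{R}^d$ be measurable sets of finite Lebesgue measure $\lambda$. Let $V_E$ be the space of all $f\in L^2(\mathbb{R}^d)$ whose Fourier transform $\hat f(\xi)=\int e^{-2\pi i\langle\xi,x\rangle}f(x)\,dx$ (extended to $L^2$) vanishes almost everywhere outside $E$, each $f$ being identified with its unique continuous representative; define $V_F$ likewise. Let $A_1,\dots,A_n$ be real invertible $d\times d$ matrices that are sampling matrices for $E$, i.e. there are constants $0<C_1$, $C_2<\infty$ with $$C_1\|f\|^2\le\sum_{i=1}^n\sum_{z\in\mathbb{Z}^d}|f(A_iz)|^2\le C_2\|f\|^2\quad\text{for all } f\in V_E,$$ and let $B_1,\dots,B_n$ be real invertible $d\times d$ matrices that are sampling matrices for $F$ in the same sense. Let $$\Theta_A:V_E\to\bigoplus_{i=1}^n\ell^2(\mathbb{Z}^d),\quad f\mapsto\big((f(A_1z))_{z\in\mathbb{Z}^d},\dots,(f(A_nz))_{z\in\mathbb{Z}^d}\big),$$ and define $\Theta_B:V_F\to\bigoplus_{i=1}^n\ell^2(\mathbb{Z}^d)$ in the same way. Put $$m_{A_i}(\xi)=\sum_{k\in\mathbb{Z}^d}\chi_E\big(A_i^{*-1}(\xi+k)\big),\qquad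 m_{B_i}(\xi)=\sum_{k\in\mathbb{Z}^d}\chi_F\big(B_i^{*-1}(\xi+k)\big),\qquad \xi\in\mathbb{R}^d,$$ and let $X_i=\{\xi: m_{A_i}(\xi)\ne0\}$ and $Y_i=\{\xi: m_{B_i}(\xi)\neq0\}$. Then: 1. if $\Theta_A(V_E)=\Theta_B(V_F)$, then $\lambda(X_i\,\Delta\,Y_i)=0$ for all $i=1,\dots,n$; 2. if $\lambda(X_i\cap Y_i)=0$ for all $i=1,\dots,n$, then $\Theta_A(V_E)\perp\Theta_B(V_F)$; 3. if $\Theta_A(V_E)\cap\Theta_B(V_F)\ne\{0\}$, then $\lambda(X_i\cap Y_i)\ne0$ for some $i$; 4. if $\Theta_A(V_E)\subset\Theta_B(V_F)$, then $\lambda(X_i\setminus Y_i)=0$ for all $i=1,\dots,n$. -/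

import Mathlib

open MeasureTheory
open scoped FourierTransform ENNReal

noncomputable section

/-- The Paley-Wiener space `V_E`: the square integrable functions on `ℝ^d` whose (`L²`-) Fourier
transform vanishes almost everywhere outside of the band `E`.  An element is represented by its
continuous representative, so that it can be evaluated at points; for a band of finite measure every
`L²`-class with Fourier transform supported in `E` has exactly one such representative, see
`existsUnique_mem_bandLimited`. -/
def bandLimited {d : ℕ} (E : Set (EuclideanSpace ℝ (Fin d))) :
    Submodule ℂ (EuclideanSpace ℝ (Fin d) → ℂ) where
  carrier := {f | Continuous f ∧ ∃ hf : MemLp f 2 volume,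
    ∀ᵐ ξ, ξ ∉ E → (𝓕 (hf.toLp f) : Lp ℂ 2 (volume : Measure (EuclideanSpace ℝ (Fin d)))) ξ = 0}
  zero_mem' := by
    refine ⟨continuous_zero, MemLp.zero, ?_⟩
    have h0 : (𝓕 ((MemLp.zero (ε := ℂ) : MemLp
        (0 : EuclideanSpace ℝ (Fin d) → ℂ) 2 volume).toLp 0) :
        Lp ℂ 2 (volume : Measure (EuclideanSpace ℝ (Fin d)))) = 0 := by
      rw [MemLp.toLp_zero]
      exact (Lp.fourierTransformₗᵢ (EuclideanSpace ℝ (Fin d)) ℂ).map_zero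
    rw [h0]
    exact Filter.Eventually.of_forall fun ξ _ => by simp
  add_mem' := by
    rintro f g ⟨hfc, hf, hfE⟩ ⟨hgc, hg, hgE⟩
    refine ⟨hfc.add hgc, hf.add hg, ?_⟩
    rw [MemLp.toLp_add hf hg, FourierTransform.fourier_add]
    filter_upwards [hfE, hgE, Lp.coeFn_add
      (𝓕 (hf.toLp f) : Lp ℂ 2 (volume : Measure (EuclideanSpace ℝ (Fin d))))
      (𝓕 (hg.toLp g))] with ξ h1 h2 h3 h4
    rw [h3, Pi.add_apply, h1 h4, h2 h4, add_zero]
  smul_mem' := by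
    rintro c f ⟨hfc, hf, hfE⟩
    refine ⟨hfc.const_smul c, hf.const_smul c, ?_⟩
    rw [MemLp.toLp_const_smul c hf, FourierTransform.fourier_smul]
    filter_upwards [hfE, Lp.coeFn_smul c
      (𝓕 (hf.toLp f) : Lp ℂ 2 (volume : Measure (EuclideanSpace ℝ (Fin d))))] with ξ h1 h3 h4
    rw [h3, Pi.smul_apply, h1 h4, smul_zero]

/-- If the band has finite measure, then every `L²`-function with Fourier transform supported in
the band has exactly one representative in `bandLimited E`. -/
theorem existsUnique_mem_bandLimited {d : ℕ} {E : Set (EuclideanSpace ℝ (Fin d))}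
    (hE : MeasurableSet E) (hfin : volume E ≠ ∞)
    (f : Lp ℂ 2 (volume : Measure (EuclideanSpace ℝ (Fin d))))
    (hf : ∀ᵐ ξ, ξ ∉ E → (𝓕 f : Lp ℂ 2 (volume : Measure (EuclideanSpace ℝ (Fin d)))) ξ = 0) :
    ∃! g : EuclideanSpace ℝ (Fin d) → ℂ, g ∈ bandLimited E ∧ g =ᵐ[volume] f := by
  set h : Lp ℂ 2 (volume : Measure (EuclideanSpace ℝ (Fin d))) := 𝓕 f with hh
  have hfh : f = 𝓕⁻ h := by rw [hh, FourierTransform.fourierInv_fourier_eq]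
  have hint : Integrable (h : EuclideanSpace ℝ (Fin d) → ℂ) := by
    have h1 : IntegrableOn (h : EuclideanSpace ℝ (Fin d) → ℂ) E := by
      have : IsFiniteMeasure (volume.restrict E) := ⟨by simpa using hfin.lt_top⟩
      exact ((Lp.memLp h).restrict E).integrable (by norm_num)
    rw [← integrable_indicator_iff hE] at h1
    refine h1.congr ?_
    filter_upwards [hf] with ξ hξ
    by_cases hm : ξ ∈ E
    · simp [hm]
    · simp [hm, hξ hm]
  set g : EuclideanSpace ℝ (Fin d) → ℂ := 𝓕⁻ (h : EuclideanSpace ℝ (Fin d) → ℂ) with hg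
  have hgc : Continuous g := by
    rw [hg, Real.fourierInv_eq_fourier_comp_neg]
    exact VectorFourier.fourierIntegral_continuous Real.continuous_fourierChar
      (by exact continuous_inner) (hint.comp_neg)
  have hgf : g =ᵐ[volume] f := by
    refine ae_eq_of_integral_contDiff_smul_eq hgc.locallyIntegrable
      ((Lp.memLp f).locallyIntegrable (by norm_num)) ?_
    intro φ hφ hφc
    let ψ : SchwartzMap (EuclideanSpace ℝ (Fin d)) ℂ :=
      (hφc.comp_left (g := fun t : ℝ => (t : ℂ)) rfl).toSchwartzMap
        (Complex.ofRealCLM.contDiff.comp hφ)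
    have hψ : ∀ x, ψ x = (φ x : ℂ) := fun _ => rfl
    have h1 : ∫ x, φ x • g x = ∫ x, h x * (𝓕⁻ ψ : SchwartzMap (EuclideanSpace ℝ (Fin d)) ℂ) x := by
      have h2 := VectorFourier.integral_fourierIntegral_smul_eq_flip (μ := volume) (ν := volume)
        (L := innerₗ (EuclideanSpace ℝ (Fin d))) Real.continuous_fourierChar continuous_inner
        hint.comp_neg ψ.integrable
      calc ∫ x, φ x • g x
          = ∫ x, (𝓕 (fun x => h (-x)) : EuclideanSpace ℝ (Fin d) → ℂ) x • ψ x := by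
            simp only [hg, Real.fourierInv_eq_fourier_comp_neg, hψ, smul_eq_mul,
              Complex.real_smul, mul_comm]
        _ = ∫ x, h (-x) • (𝓕 (ψ : EuclideanSpace ℝ (Fin d) → ℂ)) x := by
            simpa using! h2
        _ = ∫ x, h x • (𝓕 (ψ : EuclideanSpace ℝ (Fin d) → ℂ)) (-x) := by
            rw [← integral_neg_eq_self]
            simp only [neg_neg]
        _ = ∫ x, h x * (𝓕⁻ ψ : SchwartzMap (EuclideanSpace ℝ (Fin d)) ℂ) x := by
            simp only [SchwartzMap.fourierInv_coe, Real.fourierInv_eq_fourier_neg, smul_eq_mul]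
    have h3 := congrArg (fun T => T ψ) (Lp.fourierInv_toTemperedDistribution_eq h)
    simp only [TemperedDistribution.fourierInv_apply, Lp.toTemperedDistribution_apply] at h3
    rw [h1, hfh]
    simp only [smul_eq_mul, Complex.real_smul, hψ] at h3 ⊢
    rw [← h3]
    simp only [mul_comm]
  have hgm : MemLp g 2 volume := (memLp_congr_ae hgf).2 (Lp.memLp f)
  refine ⟨g, ⟨⟨hgc, hgm, ?_⟩, hgf⟩, ?_⟩
  · have : hgm.toLp g = f := by
      rw [← Lp.toLp_coeFn f (Lp.memLp f)]
      exact (MemLp.toLp_eq_toLp_iff _ _).2 hgf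
    rw [this]
    exact hf
  · rintro g' ⟨⟨hg'c, -⟩, hg'⟩
    exact (hg'c.ae_eq_iff_eq volume hgc).1 (hg'.trans hgf.symm)

/-- The point `A z` of the lattice `A ℤ^d`. -/
def latticePoint {d : ℕ} (A : Matrix (Fin d) (Fin d) ℝ) (z : Fin d → ℤ) :
    EuclideanSpace ℝ (Fin d) :=
  WithLp.toLp 2 (A.mulVec fun j => (z j : ℝ))

/-- `A_1, …, A_n` are sampling matrices for `E`: there are constants `0 < C₁` and `C₂ < ∞` with
`C₁ ‖f‖² ≤ ∑_{i, z} |f (A_i z)|² ≤ C₂ ‖f‖²` for all `f ∈ V_E`. -/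
def AreSamplingMatrices {d n : ℕ} (A : Fin n → Matrix (Fin d) (Fin d) ℝ)
    (E : Set (EuclideanSpace ℝ (Fin d))) : Prop :=
  ∃ C₁ C₂ : ℝ≥0∞, 0 < C₁ ∧ C₂ < ∞ ∧ ∀ f ∈ bandLimited E,
    C₁ * eLpNorm f 2 volume ^ 2 ≤ ∑ i, ∑' z : Fin d → ℤ, ‖f (latticePoint (A i) z)‖ₑ ^ 2 ∧
    ∑ i, ∑' z : Fin d → ℤ, ‖f (latticePoint (A i) z)‖ₑ ^ 2 ≤ C₂ * eLpNorm f 2 volume ^ 2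

theorem AreSamplingMatrices.memℓp {d n : ℕ} {A : Fin n → Matrix (Fin d) (Fin d) ℝ}
    {E : Set (EuclideanSpace ℝ (Fin d))} (hA : AreSamplingMatrices A E)
    {f : EuclideanSpace ℝ (Fin d) → ℂ} (hf : f ∈ bandLimited E) (i : Fin n) :
    Memℓp (fun z : Fin d → ℤ => f (latticePoint (A i) z)) 2 := by
  obtain ⟨C₁, C₂, -, hC₂, h⟩ := hA
  obtain ⟨-, hf2, -⟩ := id hf
  have h1 : ∑ i, ∑' z : Fin d → ℤ, ‖f (latticePoint (A i) z)‖ₑ ^ 2 ≠ ∞ :=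
    ((h f hf).2.trans_lt (ENNReal.mul_lt_top hC₂ (ENNReal.pow_lt_top hf2.2))).ne
  have h2 : ∑' z : Fin d → ℤ, ‖f (latticePoint (A i) z)‖ₑ ^ 2 ≠ ∞ :=
    ENNReal.sum_ne_top.1 h1 i (Finset.mem_univ i)
  refine memℓp_gen ?_
  simpa [ENNReal.toReal_pow] using ENNReal.summable_toReal h2

/-- The combined sampling transform
`Θ_A : V_E → ⊕_{i=1}^n ℓ²(ℤ^d)`, `f ↦ ((f (A_1 z))_z, …, (f (A_n z))_z)`. -/
def samplingTransform {d n : ℕ} {A : Fin n → Matrix (Fin d) (Fin d) ℝ}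
    {E : Set (EuclideanSpace ℝ (Fin d))} (hA : AreSamplingMatrices A E) :
    bandLimited E →ₗ[ℂ] PiLp 2 (fun _ : Fin n => lp (fun _ : Fin d → ℤ => ℂ) 2) where
  toFun f := WithLp.toLp 2 fun i =>
    ⟨fun z => (f : EuclideanSpace ℝ (Fin d) → ℂ) (latticePoint (A i) z), hA.memℓp f.2 i⟩
  map_add' _ _ := rfl
  map_smul' _ _ := rfl

/-- The periodized band indicator `ξ ↦ ∑_{k ∈ ℤ^d} χ_E (A^{*-1} (ξ + k))`. -/
def periodizedIndicator {d : ℕ} (A : Matrix (Fin d) (Fin d) ℝ)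
    (E : Set (EuclideanSpace ℝ (Fin d))) (ξ : EuclideanSpace ℝ (Fin d)) : ℝ≥0∞ :=
  ∑' k : Fin d → ℤ, E.indicator (fun _ => 1)
    (WithLp.toLp 2 ((A.transpose)⁻¹.mulVec fun j => ξ j + (k j : ℝ)))

end

/-- The circle carries its Haar probability measure, as in Mathlib's multivariate Fourier series. -/
noncomputable local instance unitAddCircleMeasureSpace : MeasureSpace UnitAddCircle :=
  ⟨AddCircle.haarAddCircle⟩

local instance isAddHaarMeasure_volume_unitAddCircle :
    Measure.IsAddHaarMeasure (volume : Measure UnitAddCircle) :=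
  inferInstanceAs (Measure.IsAddHaarMeasure AddCircle.haarAddCircle)

local instance isProbabilityMeasure_volume_unitAddCircle :
    IsProbabilityMeasure (volume : Measure UnitAddCircle) :=
  inferInstanceAs (IsProbabilityMeasure AddCircle.haarAddCircle)

section TestFunctions

open Filter Topology

/-- Integration of continuous functions, pulled back along `q`, against an integrable density. -/
theorem exists_clm_integral_comp_mul {α T : Type*} [MeasurableSpace α] {μ : Measure α}
    [TopologicalSpace T] [CompactSpace T] [MeasurableSpace T] [BorelSpace T]
    {H : α → ℂ} (hH : Integrable H μ) {q : α → T} (hq : Measurable q) :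
    ∃ L : C(T, ℂ) →L[ℂ] ℂ, ∀ φ : C(T, ℂ), L φ = ∫ x, φ (q x) * H x ∂μ := by
  have hint (φ : C(T, ℂ)) : Integrable (fun x => φ (q x) * H x) μ :=
    hH.bdd_mul (c := ‖φ‖) (φ.continuous.measurable.comp hq).aestronglyMeasurable
      (Eventually.of_forall fun x => φ.norm_coe_le_norm _)
  let L₀ : C(T, ℂ) →ₗ[ℂ] ℂ :=
    { toFun := fun φ => ∫ x, φ (q x) * H x ∂μ
      map_add' := fun φ ψ => by
        rw [← integral_add (hint φ) (hint ψ)]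
        simp only [ContinuousMap.add_apply, add_mul]
      map_smul' := fun c φ => by
        simp only [ContinuousMap.smul_apply, smul_eq_mul, mul_assoc, RingHom.id_apply]
        exact integral_const_mul _ _ }
  refine ⟨L₀.mkContinuous (∫ x, ‖H x‖ ∂μ) fun φ => ?_, fun φ => rfl⟩
  calc ‖∫ x, φ (q x) * H x ∂μ‖ ≤ ∫ x, ‖φ‖ * ‖H x‖ ∂μ := by
        refine norm_integral_le_of_norm_le (hH.norm.const_mul _) (Eventually.of_forall fun x => ?_)
        rw [norm_mul]
        gcongr
        exact φ.norm_coe_le_norm _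
    _ = (∫ x, ‖H x‖ ∂μ) * ‖φ‖ := by rw [integral_const_mul, mul_comm]

variable {α β T : Type*} [MeasurableSpace α] [MeasurableSpace β] {μ : Measure α} {ν : Measure β}
  [TopologicalSpace T] [MeasurableSpace T] [BorelSpace T] [HasOuterApproxClosed T]

/-- Continuous functions that decrease to the indicator of a closed set. -/
noncomputable def closedApprox {S : Set T} (hS : IsClosed S) (k : ℕ) : C(T, ℂ) :=
  ⟨fun t => ((hS.apprSeq k t : ℝ) : ℂ), by fun_prop⟩

theorem tendsto_integral_closedApprox {S : Set T} (hS : IsClosed S)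
    {H : α → ℂ} (hH : Integrable H μ) {q : α → T} (hq : Measurable q) :
    Tendsto (fun k => ∫ x, closedApprox hS k (q x) * H x ∂μ) atTop
      (𝓝 (∫ x in q ⁻¹' S, H x ∂μ)) := by
  rw [← integral_indicator (hq hS.measurableSet)]
  refine tendsto_integral_of_dominated_convergence (fun x => ‖H x‖) (fun k => ?_) hH.norm
    (fun k => Eventually.of_forall fun x => ?_) (Eventually.of_forall fun x => ?_)
  · refine AEStronglyMeasurable.mul ?_ hH.aestronglyMeasurable
    exact (ContinuousMap.continuous _).measurable.comp hq |>.aestronglyMeasurable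
  · rw [norm_mul]
    refine mul_le_of_le_one_left (norm_nonneg _) ?_
    simpa [closedApprox] using HasOuterApproxClosed.apprSeq_apply_le_one hS k (q x)
  · have h1 := (tendsto_pi_nhds.1 (HasOuterApproxClosed.tendsto_apprSeq hS)) (q x)
    have h2 : Tendsto (fun k => ((hS.apprSeq k (q x) : ℝ) : ℂ)) atTop
        (𝓝 (((S.indicator (fun _ => (1 : NNReal)) (q x) : NNReal) : ℝ) : ℂ)) :=
      ((Complex.continuous_ofReal.comp NNReal.continuous_coe).tendsto _).comp h1
    have h3 := h2.mul_const (H x)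
    rwa [show ((S.indicator (fun _ => (1 : NNReal)) (q x) : NNReal) : ℂ) * H x =
      (q ⁻¹' S).indicator H x by by_cases hx : q x ∈ S <;> simp [hx]] at h3

/-- If two image measures with complex densities have the same integrals of continuous functions,
then they agree on measurable sets. -/
theorem setIntegral_preimage_eq_of_forall_continuous
    {H : α → ℂ} (hH : Integrable H μ) {q : α → T} (hq : Measurable q)
    {K : β → ℂ} (hK : Integrable K ν) {r : β → T} (hr : Measurable r)
    (h : ∀ φ : C(T, ℂ), ∫ x, φ (q x) * H x ∂μ = ∫ y, φ (r y) * K y ∂ν)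
    {S : Set T} (hS : MeasurableSet S) :
    ∫ x in q ⁻¹' S, H x ∂μ = ∫ y in r ⁻¹' S, K y ∂ν := by
  have huniv : ∫ x, H x ∂μ = ∫ y, K y ∂ν := by simpa using h 1
  refine MeasurableSpace.induction_on_inter
    (C := fun S _ => ∫ x in q ⁻¹' S, H x ∂μ = ∫ y in r ⁻¹' S, K y ∂ν)
    (BorelSpace.measurable_eq.trans borel_eq_generateFrom_isClosed) isPiSystem_isClosed
    (by simp) (fun S hS => ?_) (fun S hS ih => ?_) (fun S hd hm ih => ?_) S hS
  · exact tendsto_nhds_unique (tendsto_integral_closedApprox hS hH hq)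
      (by simpa only [h] using tendsto_integral_closedApprox hS hK hr)
  · rw [Set.preimage_compl, Set.preimage_compl, setIntegral_compl (hq hS) hH,
      setIntegral_compl (hr hS) hK, ih, huniv]
  · rw [Set.preimage_iUnion, Set.preimage_iUnion,
      integral_iUnion (fun i => hq (hm i)) (fun i j hij => (hd hij).preimage q) hH.integrableOn,
      integral_iUnion (fun i => hr (hm i)) (fun i j hij => (hd hij).preimage r) hK.integrableOn]
    exact tsum_congr ih

end TestFunctions

namespace UnitAddTorus

variable {ι : Type*} [Fintype ι]

/-- Two image measures on the torus with complex densities and the same Fourier coefficients agree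
on measurable sets. -/
theorem setIntegral_preimage_eq_of_forall_mFourier
    {α β : Type*} [MeasurableSpace α] [MeasurableSpace β] {μ : Measure α} {ν : Measure β}
    {H : α → ℂ} (hH : Integrable H μ) {q : α → UnitAddTorus ι} (hq : Measurable q)
    {K : β → ℂ} (hK : Integrable K ν) {r : β → UnitAddTorus ι} (hr : Measurable r)
    (h : ∀ z, ∫ x, mFourier z (q x) * H x ∂μ = ∫ y, mFourier z (r y) * K y ∂ν)
    {S : Set (UnitAddTorus ι)} (hS : MeasurableSet S) :
    ∫ x in q ⁻¹' S, H x ∂μ = ∫ y in r ⁻¹' S, K y ∂ν := by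
  obtain ⟨L, hL⟩ := exists_clm_integral_comp_mul hH hq
  obtain ⟨M, hM⟩ := exists_clm_integral_comp_mul hK hr
  have hLM : L = M := by
    refine ContinuousLinearMap.ext_on (s := Set.range mFourier) ?_ ?_
    · exact Submodule.dense_iff_topologicalClosure_eq_top.2 span_mFourier_closure_eq_top
    · rintro _ ⟨z, rfl⟩
      rw [hL, hM, h]
  refine setIntegral_preimage_eq_of_forall_continuous hH hq hK hr (fun φ => ?_) hS
  rw [← hL, ← hM, hLM]

/-- The Riesz-Fischer theorem on the torus, with coefficients `∫ e_z G`. -/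
theorem exists_linearIsometryEquiv_integral_mFourier_mul :
    ∃ U : lp (fun _ : ι → ℤ => ℂ) 2 ≃ₗᵢ[ℂ] Lp ℂ 2 (volume : Measure (UnitAddTorus ι)),
      ∀ a z, ∫ t, mFourier z t * U a t = a z := by
  have hr : Set.range (fun z : ι → ℤ => mFourierLp 2 (-z)) = Set.range (mFourierLp 2) :=
    (Equiv.neg (ι → ℤ)).surjective.range_comp (mFourierLp 2)
  let b : HilbertBasis (ι → ℤ) ℂ (Lp ℂ 2 (volume : Measure (UnitAddTorus ι))) :=
    HilbertBasis.mk (v := fun z => mFourierLp 2 (-z))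
      (orthonormal_mFourier.comp _ neg_injective)
      (by rw [hr]; exact (span_mFourierLp_closure_eq_top (by simp)).ge)
  refine ⟨b.repr.symm, fun a z => ?_⟩
  have h1 : b.repr (b.repr.symm a) z = a z := by rw [LinearIsometryEquiv.apply_symm_apply]
  rw [← h1, b.repr_apply_apply, L2.inner_def, HilbertBasis.coe_mk]
  refine integral_congr_ae ?_
  filter_upwards [coeFn_mFourierLp 2 (-z)] with t ht
  rw [ht, RCLike.inner_apply, mFourier_neg, Complex.conj_conj, mul_comm]

/-- If all Fourier coefficients of `G` are those of an image measure that does not charge the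
measurable set `N`, then `G` vanishes almost everywhere on `N`. -/
theorem ae_eq_zero_on_of_forall_mFourier
    {α : Type*} [MeasurableSpace α] {μ : Measure α}
    {H : α → ℂ} (hH : Integrable H μ) {q : α → UnitAddTorus ι} (hq : Measurable q)
    {G : UnitAddTorus ι → ℂ} (hG : Integrable G)
    (h : ∀ z, ∫ x, mFourier z (q x) * H x ∂μ = ∫ t, mFourier z t * G t)
    {N : Set (UnitAddTorus ι)} (hN : MeasurableSet N) (hHN : ∀ᵐ x ∂μ, q x ∈ N → H x = 0) :
    ∀ᵐ t, t ∈ N → G t = 0 := by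
  rw [← ae_restrict_iff' hN]
  refine hG.restrict.ae_eq_zero_of_forall_setIntegral_eq_zero fun S hS _ => ?_
  rw [Measure.restrict_restrict hS]
  have h1 := setIntegral_preimage_eq_of_forall_mFourier hH hq hG measurable_id h (hS.inter hN)
  rw [Set.preimage_id] at h1
  rw [← h1]
  refine setIntegral_eq_zero_of_ae_eq_zero ?_
  filter_upwards [hHN] with x hx hxS
  exact hx hxS.2

end UnitAddTorus

section FourierRepresentation

variable {d : ℕ}

/-- The inverse `L²`-Fourier transform of an integrable function is given by the integral. -/
theorem fourierInv_coeFn_ae_eq {h : Lp ℂ 2 (volume : Measure (EuclideanSpace ℝ (Fin d)))}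
    (hint : Integrable (h : EuclideanSpace ℝ (Fin d) → ℂ)) :
    Continuous (𝓕⁻ (h : EuclideanSpace ℝ (Fin d) → ℂ)) ∧
      𝓕⁻ (h : EuclideanSpace ℝ (Fin d) → ℂ) =ᵐ[volume]
        (𝓕⁻ h : Lp ℂ 2 (volume : Measure (EuclideanSpace ℝ (Fin d)))) := by
  have hgc : Continuous (𝓕⁻ (h : EuclideanSpace ℝ (Fin d) → ℂ)) := by
    rw [Real.fourierInv_eq_fourier_comp_neg]
    exact VectorFourier.fourierIntegral_continuous Real.continuous_fourierChar
      (by exact continuous_inner) hint.comp_neg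
  refine ⟨hgc, ?_⟩
  refine ae_eq_of_integral_contDiff_smul_eq hgc.locallyIntegrable
    ((Lp.memLp _).locallyIntegrable (by norm_num)) ?_
  intro φ hφ hφc
  let ψ : SchwartzMap (EuclideanSpace ℝ (Fin d)) ℂ :=
    (hφc.comp_left (g := fun t : ℝ => (t : ℂ)) rfl).toSchwartzMap
      (Complex.ofRealCLM.contDiff.comp hφ)
  have hψ : ∀ x, ψ x = (φ x : ℂ) := fun _ => rfl
  have h1 : ∫ x, φ x • 𝓕⁻ (h : EuclideanSpace ℝ (Fin d) → ℂ) x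
      = ∫ x, h x * (𝓕⁻ ψ : SchwartzMap (EuclideanSpace ℝ (Fin d)) ℂ) x := by
    have h2 := VectorFourier.integral_fourierIntegral_smul_eq_flip (μ := volume) (ν := volume)
      (L := innerₗ (EuclideanSpace ℝ (Fin d))) Real.continuous_fourierChar continuous_inner
      hint.comp_neg ψ.integrable
    calc ∫ x, φ x • 𝓕⁻ (h : EuclideanSpace ℝ (Fin d) → ℂ) x
        = ∫ x, (𝓕 (fun x => h (-x)) : EuclideanSpace ℝ (Fin d) → ℂ) x • ψ x := by
          simp only [Real.fourierInv_eq_fourier_comp_neg, hψ, smul_eq_mul,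
            Complex.real_smul, mul_comm]
      _ = ∫ x, h (-x) • (𝓕 (ψ : EuclideanSpace ℝ (Fin d) → ℂ)) x := by
          simpa using! h2
      _ = ∫ x, h x • (𝓕 (ψ : EuclideanSpace ℝ (Fin d) → ℂ)) (-x) := by
          rw [← integral_neg_eq_self]
          simp only [neg_neg]
      _ = ∫ x, h x * (𝓕⁻ ψ : SchwartzMap (EuclideanSpace ℝ (Fin d)) ℂ) x := by
          simp only [SchwartzMap.fourierInv_coe, Real.fourierInv_eq_fourier_neg, smul_eq_mul]
  have h3 := congrArg (fun T => T ψ) (Lp.fourierInv_toTemperedDistribution_eq h)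
  simp only [TemperedDistribution.fourierInv_apply, Lp.toTemperedDistribution_apply] at h3
  rw [h1]
  simp only [smul_eq_mul, Complex.real_smul, hψ] at h3 ⊢
  rw [← h3]
  simp only [mul_comm]

/-- An `L²`-function that vanishes outside of a set of finite measure is integrable. -/
theorem integrable_of_memLp_two_of_ae_eq_zero {α : Type*} [MeasurableSpace α] {μ : Measure α}
    {E : Set α} (hE : MeasurableSet E) (hfin : μ E ≠ ∞) {h : α → ℂ} (hh : MemLp h 2 μ)
    (hz : ∀ᵐ x ∂μ, x ∉ E → h x = 0) : Integrable h μ := by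
  have h1 : IntegrableOn h E μ := by
    have : IsFiniteMeasure (μ.restrict E) := ⟨by simpa using hfin.lt_top⟩
    exact (hh.restrict E).integrable (by norm_num)
  rw [← integrable_indicator_iff hE] at h1
  refine h1.congr ?_
  filter_upwards [hz] with ξ hξ
  by_cases hm : ξ ∈ E
  · simp [hm]
  · simp [hm, hξ hm]

/-- Band-limited functions are pointwise given by the inverse Fourier integral of an integrable
function supported in the band. -/
theorem exists_fourierInv_eq_of_mem_bandLimited {E : Set (EuclideanSpace ℝ (Fin d))}
    (hE : MeasurableSet E) (hfin : volume E ≠ ∞) {f : EuclideanSpace ℝ (Fin d) → ℂ}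
    (hf : f ∈ bandLimited E) :
    ∃ h : EuclideanSpace ℝ (Fin d) → ℂ, Integrable h ∧ (∀ᵐ ξ, ξ ∉ E → h ξ = 0) ∧ f = 𝓕⁻ h := by
  obtain ⟨hfc, hfm, hfE⟩ := hf
  have hint := integrable_of_memLp_two_of_ae_eq_zero hE hfin (Lp.memLp _) hfE
  refine ⟨_, hint, hfE, ?_⟩
  obtain ⟨hc, hae⟩ := fourierInv_coeFn_ae_eq hint
  rw [FourierTransform.fourierInv_fourier_eq] at hae
  exact (hfc.ae_eq_iff_eq volume hc).1 (hfm.coeFn_toLp.symm.trans hae.symm)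

/-- The inverse Fourier integral of the indicator of a band belongs to its Paley-Wiener space. -/
theorem fourierInv_indicator_mem_bandLimited {E : Set (EuclideanSpace ℝ (Fin d))}
    (hE : MeasurableSet E) (hfin : volume E ≠ ∞) :
    𝓕⁻ (E.indicator fun _ => (1 : ℂ)) ∈ bandLimited E := by
  have hm : MemLp (E.indicator fun _ => (1 : ℂ)) 2
      (volume : Measure (EuclideanSpace ℝ (Fin d))) := memLp_indicator_const 2 hE 1 (.inr hfin)
  have hi : Integrable (E.indicator fun _ => (1 : ℂ))
      (volume : Measure (EuclideanSpace ℝ (Fin d))) :=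
    (integrable_indicator_iff hE).2 (integrableOn_const hfin)
  set h := hm.toLp
  have hh : h =ᵐ[volume] E.indicator fun _ => (1 : ℂ) := hm.coeFn_toLp
  obtain ⟨hc, hae⟩ := fourierInv_coeFn_ae_eq (hi.congr hh.symm)
  have heq : 𝓕⁻ (E.indicator fun _ => (1 : ℂ)) =
      𝓕⁻ (h : EuclideanSpace ℝ (Fin d) → ℂ) := by
    ext x
    rw [Real.fourierInv_eq, Real.fourierInv_eq]
    refine integral_congr_ae ?_
    filter_upwards [hh] with v hv
    rw [hv]
  rw [heq]
  have hm2 : MemLp (𝓕⁻ (h : EuclideanSpace ℝ (Fin d) → ℂ)) 2 volume :=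
    (memLp_congr_ae hae).2 (Lp.memLp _)
  refine ⟨hc, hm2, ?_⟩
  have : hm2.toLp = 𝓕⁻ h := by
    rw [← Lp.toLp_coeFn (𝓕⁻ h) (Lp.memLp _)]
    exact (MemLp.toLp_eq_toLp_iff _ _).2 hae
  rw [this, FourierTransform.fourier_fourierInv_eq]
  filter_upwards [hh] with ξ hξ hξE
  rw [hξ, Set.indicator_of_notMem hξE]

end FourierRepresentation

section TorusCover

variable {d : ℕ}

/-- The covering map `ℝ^d → (ℝ/ℤ)^d`. -/
def torusProj (x : EuclideanSpace ℝ (Fin d)) : UnitAddTorus (Fin d) :=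
  fun j => (x j : UnitAddCircle)

/-- The section of the covering map with values in `(0,1]^d`. -/
noncomputable def torusSection (t : UnitAddTorus (Fin d)) : EuclideanSpace ℝ (Fin d) :=
  WithLp.toLp 2 (UnitAddTorus.measurableEquivPiIoc 0 t).1

theorem measurable_torusProj : Measurable (torusProj (d := d)) :=
  measurable_pi_lambda _ fun j => AddCircle.measurable_mk'.comp (by fun_prop)

theorem measurable_torusSection : Measurable (torusSection (d := d)) :=
  (WithLp.measurable_toLp 2 _).comp
    (measurable_subtype_coe.comp (UnitAddTorus.measurableEquivPiIoc 0).measurable)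

theorem torusSection_torusProj (x : EuclideanSpace ℝ (Fin d)) :
    ∃ k : Fin d → ℤ, ∀ j, torusSection (torusProj x) j = x j + k j := by
  have h (j : Fin d) : ∃ k : ℤ, torusSection (torusProj x) j = x j + k := by
    have h1 : ((torusSection (torusProj x) j : ℝ) : UnitAddCircle) = (x j : UnitAddCircle) :=
      AddCircle.coe_equivIoc (p := (1 : ℝ)) (a := (0 : ℝ)) (y := (x j : UnitAddCircle))
    rw [← sub_eq_zero, ← AddCircle.coe_sub, AddCircle.coe_eq_zero_iff] at h1
    obtain ⟨k, hk⟩ := h1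
    refine ⟨k, ?_⟩
    rw [zsmul_eq_mul, mul_one] at hk
    linarith
  choose k hk using h
  exact ⟨k, hk⟩

theorem torusProj_add_intCast (x : EuclideanSpace ℝ (Fin d)) (k : Fin d → ℤ) :
    torusProj (x + WithLp.toLp 2 fun j => (k j : ℝ)) = torusProj x := by
  funext j
  have h : ((k j : ℝ) : UnitAddCircle) = 0 :=
    (AddCircle.coe_eq_zero_iff (1 : ℝ)).2 ⟨k j, by simp⟩
  simp only [torusProj, PiLp.add_apply, AddCircle.coe_add, h, add_zero]

theorem volume_preimage_torusSection_eq_zero {N : Set (EuclideanSpace ℝ (Fin d))}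
    (hN : volume N = 0) : volume (torusSection ⁻¹' N) = 0 := by
  have h1 : Measure.QuasiMeasurePreserving (torusSection (d := d)) volume volume := by
    refine (PiLp.volume_preserving_toLp (Fin d)).quasiMeasurePreserving.comp
      (f := fun t => (UnitAddTorus.measurableEquivPiIoc 0 t).1) ?_
    refine ⟨measurable_subtype_coe.comp (UnitAddTorus.measurableEquivPiIoc 0).measurable, ?_⟩
    change Measure.map (Subtype.val ∘ UnitAddTorus.measurableEquivPiIoc 0)
      (volume : Measure (UnitAddTorus (Fin d))) ≪ volume
    rw [← Measure.map_map measurable_subtype_coe (UnitAddTorus.measurableEquivPiIoc 0).measurable,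
      (UnitAddTorus.measurePreserving_equivPiIoc 0).map_eq]
    have hs : MeasurableSet {x : Fin d → ℝ | ∀ i, x i ∈ Set.Ioc (0 : ℝ) (0 + 1)} :=
      MeasurableSet.univ_pi' fun i => measurableSet_Ioc
    exact Measure.absolutelyContinuous_of_le
      ((map_comap_subtype_coe hs volume).le.trans Measure.restrict_le_self)
  exact h1.preimage_null hN

theorem fourierInv_latticePoint (A : Matrix (Fin d) (Fin d) ℝ)
    (h : EuclideanSpace ℝ (Fin d) → ℂ) (z : Fin d → ℤ) :
    𝓕⁻ h (latticePoint A z) =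
      ∫ η, UnitAddTorus.mFourier z (torusProj (Matrix.toEuclideanLin A.transpose η)) * h η := by
  rw [Real.fourierInv_eq']
  congr 1
  ext η
  rw [smul_eq_mul]
  congr 1
  have h1 : inner ℝ η (latticePoint A z) = ∑ j, Matrix.toEuclideanLin A.transpose η j * z j := by
    simp [latticePoint, PiLp.inner_apply, Matrix.toLpLin_apply, Matrix.mulVec,
      dotProduct, Finset.sum_mul]
    rw [Finset.sum_comm]
    refine Finset.sum_congr rfl fun j _ => Finset.sum_congr rfl fun k _ => ?_
    ring
  rw [h1]
  simp only [UnitAddTorus.mFourier, ContinuousMap.coe_mk, torusProj, fourier_coe_apply]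
  rw [← Complex.exp_sum]
  push_cast
  rw [Finset.mul_sum, Finset.sum_mul]
  congr 1
  refine Finset.sum_congr rfl fun j _ => ?_
  ring

theorem mem_support_periodizedIndicator {A : Matrix (Fin d) (Fin d) ℝ}
    {E : Set (EuclideanSpace ℝ (Fin d))} {ξ : EuclideanSpace ℝ (Fin d)} :
    ξ ∈ Function.support (periodizedIndicator A E) ↔ ∃ k : Fin d → ℤ,
      Matrix.toEuclideanLin (A.transpose)⁻¹ (ξ + WithLp.toLp 2 fun j => (k j : ℝ)) ∈ E := by
  rw [Function.mem_support, periodizedIndicator, ne_eq, ENNReal.tsum_eq_zero, not_forall]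
  refine exists_congr fun k => ?_
  rw [Set.indicator_apply_eq_zero, Classical.not_imp, and_iff_left one_ne_zero]
  rfl

theorem measurableSet_support_periodizedIndicator {A : Matrix (Fin d) (Fin d) ℝ}
    {E : Set (EuclideanSpace ℝ (Fin d))} (hE : MeasurableSet E) :
    MeasurableSet (Function.support (periodizedIndicator A E)) := by
  have h : Function.support (periodizedIndicator A E) = ⋃ k : Fin d → ℤ,
      (fun ξ => Matrix.toEuclideanLin (A.transpose)⁻¹
        (ξ + WithLp.toLp 2 fun j => (k j : ℝ))) ⁻¹' E := by
    ext ξ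
    simp only [mem_support_periodizedIndicator, Set.mem_iUnion, Set.mem_preimage]
  rw [h]
  refine MeasurableSet.iUnion fun k => hE.preimage ?_
  exact ((LinearMap.continuous_of_finiteDimensional _).comp (continuous_add_const _)).measurable

theorem toEuclideanLin_transpose_mem_support_periodizedIndicator
    {A : Matrix (Fin d) (Fin d) ℝ} (hA : IsUnit A) {E : Set (EuclideanSpace ℝ (Fin d))}
    {η : EuclideanSpace ℝ (Fin d)} (hη : η ∈ E) :
    Matrix.toEuclideanLin A.transpose η ∈ Function.support (periodizedIndicator A E) := by
  refine mem_support_periodizedIndicator.2 ⟨0, ?_⟩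
  have hdet : IsUnit A.transpose.det := by
    rw [Matrix.det_transpose]; exact (Matrix.isUnit_iff_isUnit_det A).1 hA
  convert hη
  ext j
  simp [Matrix.toLpLin_apply, Matrix.mulVec_add, Matrix.mulVec_mulVec,
    Matrix.nonsing_inv_mul _ hdet]
  exact congrFun (Matrix.mulVec_zero _) j

theorem torusSection_torusProj_mem_support_iff {A : Matrix (Fin d) (Fin d) ℝ}
    {E : Set (EuclideanSpace ℝ (Fin d))} (ξ : EuclideanSpace ℝ (Fin d)) :
    torusSection (torusProj ξ) ∈ Function.support (periodizedIndicator A E) ↔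
      ξ ∈ Function.support (periodizedIndicator A E) := by
  obtain ⟨m, hm⟩ := torusSection_torusProj ξ
  have h (k : Fin d → ℤ) : torusSection (torusProj ξ) + WithLp.toLp 2 (fun j => (k j : ℝ)) =
      ξ + WithLp.toLp 2 fun j => (((k + m : Fin d → ℤ) j : ℤ) : ℝ) := by
    ext j
    simp only [PiLp.add_apply, hm, Pi.add_apply, Int.cast_add]
    ring
  simp only [mem_support_periodizedIndicator, h]
  exact (Equiv.addRight m).exists_congr_left.trans (by simp)

end TorusCover

section Sampling

variable {d : ℕ} {E F : Set (EuclideanSpace ℝ (Fin d))}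

theorem measurable_torusProj_toEuclideanLin (M : Matrix (Fin d) (Fin d) ℝ) :
    Measurable fun η => torusProj (Matrix.toEuclideanLin M η) :=
  measurable_torusProj.comp (LinearMap.continuous_of_finiteDimensional _).measurable

theorem quasiMeasurePreserving_toEuclideanLin_inv {A : Matrix (Fin d) (Fin d) ℝ} (hA : IsUnit A) :
    Measure.QuasiMeasurePreserving (Matrix.toEuclideanLin (A.transpose)⁻¹) volume volume := by
  refine Measure.LinearMap.quasiMeasurePreserving _ _ ?_
  have h : IsUnit (A.transpose)⁻¹.det := by
    rw [Matrix.isUnit_nonsing_inv_det_iff, Matrix.det_transpose]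
    exact (Matrix.isUnit_iff_isUnit_det A).1 hA
  rw [Matrix.toEuclideanLin, Matrix.toLpLin_eq_toLin, LinearMap.det_toLin]
  exact h.ne_zero

/-- If the samples along `A` of band-limited functions on `E` are samples along `B` of band-limited
functions on `F`, then the support of the periodization of `E` is contained in that of `F`. -/
theorem volume_support_periodizedIndicator_diff_eq_zero
    (hE : MeasurableSet E) (hF : MeasurableSet F) (hEfin : volume E ≠ ∞) (hFfin : volume F ≠ ∞)
    {A B : Matrix (Fin d) (Fin d) ℝ} (hA : IsUnit A) (hB : IsUnit B)
    (hsub : ∀ f ∈ bandLimited E, ∃ g ∈ bandLimited F,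
      ∀ z, f (latticePoint A z) = g (latticePoint B z)) :
    volume (Function.support (periodizedIndicator A E) \
      Function.support (periodizedIndicator B F)) = 0 := by
  set Y := Function.support (periodizedIndicator B F) with hY
  have hYm : MeasurableSet Y := measurableSet_support_periodizedIndicator hF
  obtain ⟨g, hg, hfg⟩ := hsub _ (fourierInv_indicator_mem_bandLimited hE hEfin)
  obtain ⟨h, hint, hhF, rfl⟩ := exists_fourierInv_eq_of_mem_bandLimited hF hFfin hg
  simp only [fourierInv_latticePoint] at hfg
  have hi : Integrable (E.indicator fun _ => (1 : ℂ))
      (volume : Measure (EuclideanSpace ℝ (Fin d))) :=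
    (integrable_indicator_iff hE).2 (integrableOn_const hEfin)
  have key := UnitAddTorus.setIntegral_preimage_eq_of_forall_mFourier hi
    (measurable_torusProj_toEuclideanLin A.transpose) hint
    (measurable_torusProj_toEuclideanLin B.transpose) hfg
    (measurable_torusSection hYm.compl)
  have h0 : volume ({η | Matrix.toEuclideanLin A.transpose η ∉ Y} ∩ E) = 0 := by
    have hpre : (fun η => torusProj (Matrix.toEuclideanLin A.transpose η)) ⁻¹'
        (torusSection ⁻¹' Yᶜ) = {η | Matrix.toEuclideanLin A.transpose η ∉ Y} := by
      ext η
      exact not_congr (torusSection_torusProj_mem_support_iff _)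
    rw [setIntegral_eq_zero_of_ae_eq_zero (f := h), hpre, setIntegral_indicator hE,
      setIntegral_const, Complex.real_smul, mul_one, Complex.ofReal_eq_zero,
      measureReal_eq_zero_iff (measure_ne_top_of_subset Set.inter_subset_right hEfin)] at key
    · exact key
    · filter_upwards [hhF] with η hη hηS
      refine hη fun hηF => hηS ?_
      exact (torusSection_torusProj_mem_support_iff _).2
        (toEuclideanLin_transpose_mem_support_periodizedIndicator hB hηF)
  have hcover : Function.support (periodizedIndicator A E) \ Y ⊆ ⋃ k : Fin d → ℤ,
      (fun ξ => Matrix.toEuclideanLin (A.transpose)⁻¹ (ξ + WithLp.toLp 2 fun j => (k j : ℝ))) ⁻¹'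
        ({η | Matrix.toEuclideanLin A.transpose η ∉ Y} ∩ E) := by
    rintro ξ ⟨hξ, hξY⟩
    obtain ⟨k, hk⟩ := mem_support_periodizedIndicator.1 hξ
    refine Set.mem_iUnion.2 ⟨k, fun hmem => hξY ?_, hk⟩
    have hinv : Matrix.toEuclideanLin A.transpose (Matrix.toEuclideanLin (A.transpose)⁻¹
        (ξ + WithLp.toLp 2 fun j => (k j : ℝ))) = ξ + WithLp.toLp 2 fun j => (k j : ℝ) := by
      have hdet : IsUnit A.transpose.det := by
        rw [Matrix.det_transpose]; exact (Matrix.isUnit_iff_isUnit_det A).1 hA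
      simp only [Matrix.toLpLin_apply, Matrix.mulVec_mulVec, Matrix.mul_nonsing_inv _ hdet,
        Matrix.one_mulVec]
    have hmemY : ξ + WithLp.toLp 2 (fun j => (k j : ℝ)) ∈ Y := hinv ▸ hmem
    rwa [hY, ← torusSection_torusProj_mem_support_iff, torusProj_add_intCast,
      torusSection_torusProj_mem_support_iff] at hmemY
  refine measure_mono_null hcover (measure_iUnion_null fun k => ?_)
  exact ((quasiMeasurePreserving_toEuclideanLin_inv hA).comp
    (quasiMeasurePreserving_add_right volume _)).preimage_null h0

/-- The `L²`-function on the torus whose Fourier coefficients are the samples of a band-limited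
function vanishes outside of the support of the periodized band. -/
theorem ae_eq_zero_of_integral_mFourier_eq_sample
    (hE : MeasurableSet E) (hEfin : volume E ≠ ∞) {A : Matrix (Fin d) (Fin d) ℝ} (hA : IsUnit A)
    {f : EuclideanSpace ℝ (Fin d) → ℂ} (hf : f ∈ bandLimited E)
    {G : UnitAddTorus (Fin d) → ℂ} (hG : Integrable G)
    (h : ∀ z, ∫ t, UnitAddTorus.mFourier z t * G t = f (latticePoint A z)) :
    ∀ᵐ t, torusSection t ∉ Function.support (periodizedIndicator A E) → G t = 0 := by
  obtain ⟨h₀, hint, hE₀, rfl⟩ := exists_fourierInv_eq_of_mem_bandLimited hE hEfin hf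
  refine UnitAddTorus.ae_eq_zero_on_of_forall_mFourier hint
    (measurable_torusProj_toEuclideanLin A.transpose) hG
    (fun z => by rw [h, fourierInv_latticePoint])
    (measurable_torusSection (measurableSet_support_periodizedIndicator hE).compl) ?_
  filter_upwards [hE₀] with η hη hηN
  refine hη fun hηE => hηN ?_
  exact (torusSection_torusProj_mem_support_iff _).2
    (toEuclideanLin_transpose_mem_support_periodizedIndicator hA hηE)

/-- Sample sequences are orthogonal if the supports of the periodized bands are disjoint. -/
theorem inner_samples_eq_zero
    (hE : MeasurableSet E) (hF : MeasurableSet F) (hEfin : volume E ≠ ∞) (hFfin : volume F ≠ ∞)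
    {A B : Matrix (Fin d) (Fin d) ℝ} (hA : IsUnit A) (hB : IsUnit B)
    (hXY : volume (Function.support (periodizedIndicator A E) ∩
      Function.support (periodizedIndicator B F)) = 0)
    {f g : EuclideanSpace ℝ (Fin d) → ℂ} (hf : f ∈ bandLimited E) (hg : g ∈ bandLimited F)
    {a b : lp (fun _ : Fin d → ℤ => ℂ) 2} (ha : ∀ z, a z = f (latticePoint A z))
    (hb : ∀ z, b z = g (latticePoint B z)) : inner ℂ a b = 0 := by
  obtain ⟨U, hU⟩ := UnitAddTorus.exists_linearIsometryEquiv_integral_mFourier_mul (ι := Fin d)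
  have hi (c : lp (fun _ : Fin d → ℤ => ℂ) 2) : Integrable (U c) :=
    (Lp.memLp (U c)).integrable (by norm_num)
  have h1 := ae_eq_zero_of_integral_mFourier_eq_sample hE hEfin hA hf (hi a)
    fun z => by rw [hU, ha]
  have h2 := ae_eq_zero_of_integral_mFourier_eq_sample hF hFfin hB hg (hi b)
    fun z => by rw [hU, hb]
  have h3 := measure_eq_zero_iff_ae_notMem.1 (volume_preimage_torusSection_eq_zero hXY)
  rw [← U.inner_map_map, L2.inner_def]
  refine integral_eq_zero_of_ae ?_
  filter_upwards [h1, h2, h3] with t ht1 ht2 ht3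
  by_cases hX : torusSection t ∈ Function.support (periodizedIndicator A E)
  · rw [ht2 fun hY => ht3 ⟨hX, hY⟩, inner_zero_right, Pi.zero_apply]
  · rw [ht1 hX, inner_zero_left, Pi.zero_apply]

end Sampling

theorem theoremT {d n : ℕ} (E F : Set (EuclideanSpace ℝ (Fin d)))
    (hE : MeasurableSet E) (hF : MeasurableSet F)
    (hEfin : volume E ≠ ∞) (hFfin : volume F ≠ ∞)
    (A B : Fin n → Matrix (Fin d) (Fin d) ℝ)
    (hAinv : ∀ i, IsUnit (A i)) (hBinv : ∀ i, IsUnit (B i))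
    (hA : AreSamplingMatrices A E) (hB : AreSamplingMatrices B F)
    (X Y : Fin n → Set (EuclideanSpace ℝ (Fin d)))
    (hX : ∀ i, X i = Function.support (periodizedIndicator (A i) E))
    (hY : ∀ i, Y i = Function.support (periodizedIndicator (B i) F)) :
    (LinearMap.range (samplingTransform hA) = LinearMap.range (samplingTransform hB) →
      ∀ i, volume (symmDiff (X i) (Y i)) = 0) ∧
    ((∀ i, volume (X i ∩ Y i) = 0) →
      LinearMap.range (samplingTransform hA) ⟂ LinearMap.range (samplingTransform hB)) ∧
    (LinearMap.range (samplingTransform hA) ⊓ LinearMap.range (samplingTransform hB) ≠ ⊥ →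
      ∃ i, volume (X i ∩ Y i) ≠ 0) ∧
    (LinearMap.range (samplingTransform hA) ≤ LinearMap.range (samplingTransform hB) →
      ∀ i, volume (X i \ Y i) = 0) := by
  obtain rfl : X = fun i => Function.support (periodizedIndicator (A i) E) := funext hX
  obtain rfl : Y = fun i => Function.support (periodizedIndicator (B i) F) := funext hY
  have sub_of_le {E F : Set (EuclideanSpace ℝ (Fin d))} {A B : Fin n → Matrix (Fin d) (Fin d) ℝ}
      {hA : AreSamplingMatrices A E} {hB : AreSamplingMatrices B F}
      (h : LinearMap.range (samplingTransform hA) ≤ LinearMap.range (samplingTransform hB))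
      (i : Fin n) (f : EuclideanSpace ℝ (Fin d) → ℂ) (hf : f ∈ bandLimited E) :
      ∃ g ∈ bandLimited F, ∀ z, f (latticePoint (A i) z) = g (latticePoint (B i) z) := by
    obtain ⟨g, hg⟩ := h (LinearMap.mem_range_self _ ⟨f, hf⟩)
    refine ⟨g, g.2, fun z => ?_⟩
    exact (congrArg (fun v => v i z) hg).symm
  have diff_null (h : LinearMap.range (samplingTransform hA) ≤
      LinearMap.range (samplingTransform hB)) (i : Fin n) :=
    volume_support_periodizedIndicator_diff_eq_zero hE hF hEfin hFfin (hAinv i) (hBinv i)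
      (sub_of_le h i)
  have diff_null' (h : LinearMap.range (samplingTransform hB) ≤
      LinearMap.range (samplingTransform hA)) (i : Fin n) :=
    volume_support_periodizedIndicator_diff_eq_zero hF hE hFfin hEfin (hBinv i) (hAinv i)
      (sub_of_le h i)
  have ortho (h : ∀ i, volume (Function.support (periodizedIndicator (A i) E) ∩
      Function.support (periodizedIndicator (B i) F)) = 0) :
      LinearMap.range (samplingTransform hA) ⟂ LinearMap.range (samplingTransform hB) := by
    rw [Submodule.isOrtho_iff_inner_eq]
    rintro _ ⟨f, rfl⟩ _ ⟨g, rfl⟩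
    rw [PiLp.inner_apply]
    exact Finset.sum_eq_zero fun i _ => inner_samples_eq_zero hE hF hEfin hFfin (hAinv i)
      (hBinv i) (h i) f.2 g.2 (fun _ => rfl) (fun _ => rfl)
  refine ⟨fun h i => ?_, ortho, fun h => ?_, diff_null⟩
  · exact measure_union_null (diff_null h.le i) (diff_null' h.ge i)
  · by_contra! hc
    exact h (ortho hc).disjoint.eq_bot
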